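/- Let $\mathbb{K}$ be an algebraically closed field of characteristic $\neq 2$, and let $A$ and $B$ be skew-symmetric bilinear forms on a finite-dimensional vector space $V$ over $\mathbb{K}$. Then there is a basis of $V$ in which the matrices of both forms are block-diagonal with blocks of the same sizes, $A=\operatorname{diag}(A_1,\dots,A_m)$ and $B=\operatorname{diag}(B_1,\dots,B_m)$, and for each $i$ $$A_i=\begin{pmatrix}0&M_i\\-M_i^{T}&0\end{pmatrix},\qquad B_i=\begin{pmatrix}0&N_i\\-N_i^{T}&0\end{pmatrix},$$ where the pair $(M_i,N_i)$ is one of the following. Here $I_n$ is the $n\times n$ identity matrix, and $J_n(\lambda)$ is the $n\times n$ matrix with $\lambda$ on the diagonal, $1$ on the first superdiagonal and $0$ elsewhere. 1. (Jordan block with eigenvalue $\lambda\in\mathbb{K}$) $M_i=J_n(\lambda)$ and $N_i=I_n$, for some $n\ge 1$. 2. (Jordan block with eigenvalue $\infty$) $M_i=I_n$ and $N_i=J_n(0)$, for some $n\ge 1$. 3. (Kronecker block) $M_i=(I_k\mid 0)$ and $N_i=(0\mid I_k)$ are $k\times(k+1)$ matrices, for some $k\ge 0$, where $0$ is a zero column;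 thus $A_i$ and $B_i$ are $(2k+1)\times(2k+1)$ matrices, and for $k=0$ both are the $1\times 1$ zero matrix. The values of $n$, $k$ and $\lambda$ may depend on $i$. -/

import Mathlib

/-- The kinds of blocks in the Jordan–Kronecker form of a pair of skew-symmetric forms over `K`:
a `2n × 2n` Jordan block (`n ≥ 1`) with eigenvalue `lam ∈ K`, a `2n × 2n` Jordan block (`n ≥ 1`)
with eigenvalue `∞`, and a `(2k+1) × (2k+1)` Kronecker block (`k ≥ 0`). -/
inductive JKBlock (K : Type*) where
  | jordan (n : ℕ) (hn : 1 ≤ n) (lam : K)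
  | jordanInfty (n : ℕ) (hn : 1 ≤ n)
  | kronecker (k : ℕ)

namespace JKBlock

/-- The number of rows of the upper right corner of a block. -/
def rows {K : Type*} : JKBlock K → ℕ
  | jordan n _ _ => n
  | jordanInfty n _ => n
  | kronecker k => k

/-- The number of columns of the upper right corner of a block. -/
def cols {K : Type*} : JKBlock K → ℕ
  | jordan n _ _ => n
  | jordanInfty n _ => n
  | kronecker k => k + 1

/-- The row and column indices of a block. -/
abbrev Index {K : Type*} (b : JKBlock K) : Type := Fin b.rows ⊕ Fin b.cols

/-- The `p × q` matrix with `a` on the main diagonal, `c` on the first superdiagonal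
and zeros elsewhere. -/
def bidiagonal {K : Type*} [Zero K] (p q : ℕ) (a c : K) : Matrix (Fin p) (Fin q) K :=
  Matrix.of fun i j =>
    if (i : ℕ) = (j : ℕ) then a else if (i : ℕ) + 1 = (j : ℕ) then c else 0

/-- The upper right corner of the block of the first form. -/
def cornerA {K : Type*} [Field K] : (b : JKBlock K) → Matrix (Fin b.rows) (Fin b.cols) K
  | jordan n _ lam => bidiagonal n n lam 1
  | jordanInfty n _ => bidiagonal n n 1 0
  | kronecker k => bidiagonal k (k + 1) 1 0

/-- The upper right corner of the block of the second form. -/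
def cornerB {K : Type*} [Field K] : (b : JKBlock K) → Matrix (Fin b.rows) (Fin b.cols) K
  | jordan n _ _ => bidiagonal n n 1 0
  | jordanInfty n _ => bidiagonal n n 0 1
  | kronecker k => bidiagonal k (k + 1) 0 1

/-- The block of the first form: zero diagonal corners, upper right corner `C`,
lower left corner `-Cᵀ`. -/
def matA {K : Type*} [Field K] (b : JKBlock K) : Matrix b.Index b.Index K :=
  Matrix.fromBlocks 0 b.cornerA (-b.cornerA.transpose) 0

/-- The block of the second form: zero diagonal corners, upper right corner `C`,
lower left corner `-Cᵀ`. -/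
def matB {K : Type*} [Field K] (b : JKBlock K) : Matrix b.Index b.Index K :=
  Matrix.fromBlocks 0 b.cornerB (-b.cornerB.transpose) 0

end JKBlock

/-! By induction on `dim V` it is enough to split off one block. A block is spanned by two chains
`p` and `q`, where `q` comes from the pencil `B - t A`: it is a polynomial null vector `∑ q j t ^ j`
of least degree if there is one (Kronecker block), and otherwise a longest Jordan chain at `t = 0`
(eigenvalue `∞`; for a finite eigenvalue `c` replace the pair `(A, B)` by `(B, A - c B)`). Chains
are isotropic for both forms because the forms are alternating, so `p` only has to be dual to `q`,
and this is a condition on the first functional `A (p 0)` alone. If no functional starting a chain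
`p` satisfies it, then by duality some combination of the `q j` is the start of a further chain,
which contradicts the choice of `q`. -/

section DirectSums

open LinearMap (BilinForm)
open LinearMap.BilinForm (toMatrix toMatrix_apply)
open Module (Basis Dual)

variable {R M : Type*} [CommRing R] [AddCommGroup M] [Module R M] {A B : BilinForm R M}
variable {m n : Type*} [Fintype m] [DecidableEq m] [Fintype n] [DecidableEq n]

/-- In some basis of `M` indexed by `n`, the forms `A` and `B` have the matrices `P` and `Q`. -/
def HasMatrices (A B : BilinForm R M) (P Q : Matrix n n R) : Prop :=
  ∃ e : Basis n R M, toMatrix e A = P ∧ toMatrix e B = Q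

/-- The module is the direct sum of two submodules orthogonal to each other for both forms, and
on the first of them the forms have the matrices `P` and `Q` in some basis. -/
def SplitsOff (A B : BilinForm R M) (P Q : Matrix n n R) : Prop :=
  ∃ U W : Submodule R M, IsCompl U W ∧ (∀ u ∈ U, ∀ w ∈ W, A u w = 0 ∧ B u w = 0) ∧
    HasMatrices (A.restrict U) (B.restrict U) P Q

theorem HasMatrices.of_submatrix (f : m ≃ n) {P Q : Matrix n n R}
    (h : HasMatrices A B (P.submatrix f f) (Q.submatrix f f)) : HasMatrices A B P Q := by
  obtain ⟨e, hP, hQ⟩ := h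
  refine ⟨e.reindex f, ?_, ?_⟩ <;> ext i j
  · simpa [toMatrix_apply] using congr_fun₂ hP (f.symm i) (f.symm j)
  · simpa [toMatrix_apply] using congr_fun₂ hQ (f.symm i) (f.symm j)

theorem HasMatrices.of_sub_smul {c : R} {P Q : Matrix n n R}
    (h : HasMatrices B (A - c • B) P Q) : HasMatrices A B (Q + c • P) P := by
  obtain ⟨e, rfl, rfl⟩ := h
  exact ⟨e, by rw [← map_smul, ← map_add]; exact congrArg _ (sub_add_cancel A (c • B)).symm, rfl⟩

theorem SplitsOff.of_sub_smul {c : R} {P Q : Matrix n n R}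
    (h : SplitsOff B (A - c • B) P Q) : SplitsOff A B (Q + c • P) P := by
  obtain ⟨U, W, hUW, horth, hU⟩ := h
  refine ⟨U, W, hUW, fun u hu w hw => ?_, HasMatrices.of_sub_smul hU⟩
  obtain ⟨hB, hsub⟩ := horth u hu w hw
  exact ⟨by simpa [hB] using hsub, hB⟩

theorem toMatrix_prod_map_prodEquivOfIsCompl (hA : A.IsRefl) {U W : Submodule R M}
    (hUW : IsCompl U W) (horth : ∀ u ∈ U, ∀ w ∈ W, A u w = 0) (e : Basis m R U)
    (f : Basis n R W) :
    toMatrix ((e.prod f).map (U.prodEquivOfIsCompl W hUW)) A =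
      Matrix.fromBlocks (toMatrix e (A.restrict U)) 0 0 (toMatrix f (A.restrict W)) := by
  have hUW' : ∀ i j, A (e i) (f j) = 0 := fun i j => horth _ (e i).2 _ (f j).2
  ext (i | i) (j | j) <;> simp [toMatrix_apply, hUW', hA.eq_zero (hUW' _ _)]

theorem HasMatrices.fromBlocks (hA : A.IsRefl) (hB : B.IsRefl) {U W : Submodule R M}
    (hUW : IsCompl U W) (horth : ∀ u ∈ U, ∀ w ∈ W, A u w = 0 ∧ B u w = 0)
    {P Q : Matrix m m R} {P' Q' : Matrix n n R}
    (hU : HasMatrices (A.restrict U) (B.restrict U) P Q)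
    (hW : HasMatrices (A.restrict W) (B.restrict W) P' Q') :
    HasMatrices A B (Matrix.fromBlocks P 0 0 P') (Matrix.fromBlocks Q 0 0 Q') := by
  obtain ⟨e, rfl, rfl⟩ := hU
  obtain ⟨f, rfl, rfl⟩ := hW
  exact ⟨_, toMatrix_prod_map_prodEquivOfIsCompl hA hUW (fun u hu w hw => (horth u hu w hw).1) e f,
    toMatrix_prod_map_prodEquivOfIsCompl hB hUW (fun u hu w hw => (horth u hu w hw).2) e f⟩

/-- The first summand of a disjoint union over `Fin (k + 1)`, separated from the others. -/
def sumSigmaFinSucc {k : ℕ} (n : Fin (k + 1) → Type*) :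
    (n 0 ⊕ Σ i : Fin k, n i.succ) ≃ Σ i, n i where
  toFun := Sum.elim (Sigma.mk 0) fun x => ⟨x.1.succ, x.2⟩
  invFun x := Fin.cases (motive := fun i => n i → _) Sum.inl (fun i y => Sum.inr ⟨i, y⟩) x.1 x.2
  left_inv := by rintro (x | x) <;> rfl
  right_inv := by rintro ⟨i, x⟩; cases i using Fin.cases <;> rfl

theorem blockDiagonal'_submatrix_sumSigmaFinSucc {k : ℕ} {n : Fin (k + 1) → Type*}
    (P : ∀ i, Matrix (n i) (n i) R) :
    (Matrix.blockDiagonal' P).submatrix (sumSigmaFinSucc n) (sumSigmaFinSucc n) =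
      Matrix.fromBlocks (P 0) 0 0 (Matrix.blockDiagonal' fun i : Fin k => P i.succ) := by
  ext (x | ⟨i, x⟩) (y | ⟨j, y⟩)
  · exact Matrix.blockDiagonal'_apply_eq P 0 x y
  · exact Matrix.blockDiagonal'_apply_ne P x y (Fin.succ_ne_zero j).symm
  · exact Matrix.blockDiagonal'_apply_ne P x y (Fin.succ_ne_zero i)
  · change Matrix.blockDiagonal' P ⟨i.succ, x⟩ ⟨j.succ, y⟩ =
      Matrix.blockDiagonal' (fun i : Fin k => P i.succ) ⟨i, x⟩ ⟨j, y⟩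
    rcases eq_or_ne i j with rfl | hij
    · simp only [Matrix.blockDiagonal'_apply_eq]
    · rw [Matrix.blockDiagonal'_apply_ne _ _ _ hij,
        Matrix.blockDiagonal'_apply_ne _ _ _ ((Fin.succ_injective k).ne hij)]

theorem HasMatrices.blockDiagonal' (hA : A.IsRefl) (hB : B.IsRefl) {U W : Submodule R M}
    (hUW : IsCompl U W) (horth : ∀ u ∈ U, ∀ w ∈ W, A u w = 0 ∧ B u w = 0) {k : ℕ}
    {n : Fin (k + 1) → Type*} [∀ i, Fintype (n i)] [∀ i, DecidableEq (n i)]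
    {P Q : ∀ i, Matrix (n i) (n i) R}
    (hU : HasMatrices (A.restrict U) (B.restrict U) (P 0) (Q 0))
    (hW : HasMatrices (A.restrict W) (B.restrict W)
      (Matrix.blockDiagonal' fun i : Fin k => P i.succ)
      (Matrix.blockDiagonal' fun i : Fin k => Q i.succ)) :
    HasMatrices A B (Matrix.blockDiagonal' P) (Matrix.blockDiagonal' Q) := by
  refine .of_submatrix (sumSigmaFinSucc n) ?_
  rw [blockDiagonal'_submatrix_sumSigmaFinSucc, blockDiagonal'_submatrix_sumSigmaFinSucc]
  exact .fromBlocks hA hB hUW horth hU hW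

theorem isCompl_span_range_ker_pi {ι : Type*} [Finite ι] [DecidableEq ι] {e : ι → M}
    {ξ : ι → Dual R M} (hξ : ∀ x y, ξ x (e y) = if x = y then 1 else 0) :
    IsCompl (Submodule.span R (Set.range e)) (LinearMap.ker (LinearMap.pi ξ)) := by
  cases nonempty_fintype ι
  have hpi : ∀ y, LinearMap.pi ξ (e y) = Pi.single y 1 := fun y => by
    ext x
    simp [hξ, Pi.single_apply]
  have hli : LinearIndependent R (LinearMap.pi ξ ∘ e) := by
    rw [show LinearMap.pi ξ ∘ e = fun y => Pi.single y 1 from funext hpi]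
    exact Pi.linearIndependent_single_one ι R
  refine ⟨Submodule.range_ker_disjoint hli, Submodule.codisjoint_iff_exists_add_eq.2 fun v => ?_⟩
  refine ⟨∑ y, ξ y v • e y, v - ∑ y, ξ y v • e y, ?_, ?_, add_sub_cancel _ _⟩
  · exact Submodule.sum_smul_mem _ _ fun y _ => Submodule.subset_span ⟨y, rfl⟩
  · simp [funext_iff, hξ]

theorem SplitsOff.of_dual_family {e : n → M} {ξ : n → Dual R M}
    (hξ : ∀ x y, ξ x (e y) = if x = y then 1 else 0)
    (horth : ∀ w, (∀ x, ξ x w = 0) → ∀ x, A (e x) w = 0 ∧ B (e x) w = 0) :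
    SplitsOff A B (Matrix.of fun x y => A (e x) (e y)) (Matrix.of fun x y => B (e x) (e y)) := by
  have hli : LinearIndependent R e :=
    .of_pairwise_dual_eq_zero_one e ξ (fun x y hxy => by simp [hξ, hxy]) fun x => by simp [hξ]
  refine ⟨_, _, isCompl_span_range_ker_pi hξ, fun u hu w hw => ?_, Basis.span hli, ?_, ?_⟩
  · have hw' : ∀ x, ξ x w = 0 := congr_fun hw
    induction hu using Submodule.span_induction with
    | mem u hu => obtain ⟨x, rfl⟩ := hu; exact horth w hw' x
    | zero => simp
    | add u v _ _ hu hv => simp [hu, hv]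
    | smul c u _ hu => simp [hu]
  · ext x y
    simp [toMatrix_apply, Basis.span_apply]
  · ext x y
    simp [toMatrix_apply, Basis.span_apply]

end DirectSums

section DualChains

open LinearMap (BilinForm)
open JKBlock (bidiagonal)
open Module (Dual)

variable {R M : Type*} [CommRing R] [AddCommGroup M] [Module R M] {A B : BilinForm R M}

/-- The matrix of an alternating form in a basis made of two isotropic halves paired by `C`. -/
def skewBlock {m n : Type*} (C : Matrix m n R) : Matrix (m ⊕ n) (m ⊕ n) R :=
  Matrix.fromBlocks 0 C (-C.transpose) 0

theorem skewBlock_add_smul {m n : Type*} (C D : Matrix m n R) (c : R) :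
    skewBlock C + c • skewBlock D = skewBlock (C + c • D) := by
  simp [skewBlock, Matrix.fromBlocks_add, Matrix.fromBlocks_smul, add_comm]

theorem bidiagonal_add_smul (m n : ℕ) (a c : R) :
    bidiagonal m n 0 c + a • bidiagonal m n 1 0 = bidiagonal m n a c := by
  ext i j
  simp only [bidiagonal, Matrix.add_apply, Matrix.smul_apply, Matrix.of_apply, smul_eq_mul]
  split_ifs <;> simp

/-- The vectors `z 0, …, z (n - 1)` satisfy `A (z j) = B (z (j + 1))`: up to the two ends,
`∑ z j t ^ j` is a null vector of the pencil `B - t A`. -/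
def IsPencilChain (A B : BilinForm R M) (n : ℕ) (z : ℕ → M) : Prop :=
  ∀ j, j + 1 < n → A (z j) = B (z (j + 1))

theorem IsPencilChain.apply_add_eq_zero (hA : A.IsAlt) (hB : B.IsAlt) {n : ℕ} {z : ℕ → M}
    (hz : IsPencilChain A B n z) (d : ℕ) {i : ℕ} (hi : i + d < n) : A (z i) (z (i + d)) = 0 := by
  induction d using Nat.twoStepInduction generalizing i with
  | zero => exact hA.self_eq_zero _
  | one => rw [hz i hi, hB.self_eq_zero]
  | more d ih _ =>
    calc A (z i) (z (i + (d + 2)))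
        = B (z (i + 1)) (z (i + 1 + d + 1)) := by
          rw [hz i (by omega), show i + (d + 2) = i + 1 + d + 1 by omega]
      _ = A (z (i + 1)) (z (i + 1 + d)) := by
          rw [← hB.neg_eq, ← hz _ (by omega), hA.neg_eq]
      _ = 0 := ih (by omega)

theorem IsPencilChain.apply_eq_zero (hA : A.IsAlt) (hB : B.IsAlt) {n : ℕ} {z : ℕ → M}
    (hz : IsPencilChain A B n z) {i j : ℕ} (hi : i < n) (hj : j < n) :
    A (z i) (z j) = 0 ∧ B (z i) (z j) = 0 := by
  have hAz : ∀ {i j}, i < n → j < n → A (z i) (z j) = 0 := by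
    intro i j hi hj
    rcases le_total i j with h | h
    · obtain ⟨d, rfl⟩ := Nat.exists_eq_add_of_le h
      exact hz.apply_add_eq_zero hA hB d hj
    · obtain ⟨d, rfl⟩ := Nat.exists_eq_add_of_le h
      exact hA.isRefl.eq_zero (hz.apply_add_eq_zero hA hB d hi)
  refine ⟨hAz hi hj, ?_⟩
  rcases i with _ | i
  · rcases j with _ | j
    · exact hB.self_eq_zero _
    · exact hB.isRefl.eq_zero (by rw [← hz j hj, hAz (by omega) hi])
  · rw [← hz i hi, hAz (by omega) hj]

/-- Chains `p 0, …, p (a - 1)` and `q 0, …, q (b - 1)` spanning a Jordan block (`b = a`) or a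
Kronecker block (`b = a + 1`). The functionals `φ i`, which are `A (p i)` for `i < a` and
`B (p (i - 1))` for `0 < i ≤ a`, are dual to the vectors `q j`; they are recorded separately
because for `a = 0` the functional `φ 0` does not come from the forms. -/
structure DualChains (A B : BilinForm R M) (a b : ℕ) (p q : ℕ → M) (φ : ℕ → Dual R M) : Prop where
  A_p : ∀ i < a, A (p i) = φ i
  B_p : ∀ i < a, B (p i) = φ (i + 1)
  chain_q : IsPencilChain A B b q
  B_q_zero : B (q 0) = 0
  last : b = a ∧ φ a = 0 ∨ b = a + 1 ∧ A (q a) = 0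
  φ_zero_q : ∀ j < b, φ 0 (q j) = if j = 0 then 1 else 0

namespace DualChains

variable {a b : ℕ} {p q : ℕ → M} {φ : ℕ → Dual R M}

theorem le_and_le_succ (h : DualChains A B a b p q φ) : a ≤ b ∧ b ≤ a + 1 := by
  rcases h.last with h | h <;> omega

theorem chain_p (h : DualChains A B a b p q φ) : IsPencilChain B A a p := fun i hi => by
  rw [h.B_p i (by omega), h.A_p (i + 1) hi]

theorem φ_apply_q (h : DualChains A B a b p q φ) (hA : A.IsAlt) (hB : B.IsAlt) {i j : ℕ}
    (hi : i ≤ a) (hj : j < b) : φ i (q j) = if i = j then 1 else 0 := by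
  induction i generalizing j with
  | zero => simpa [eq_comm] using h.φ_zero_q j hj
  | succ i ih =>
    rw [← h.B_p i hi, ← hB.neg_eq]
    rcases j with _ | j
    · simp [h.B_q_zero]
    · rw [← h.chain_q j hj, hA.neg_eq, h.A_p i hi, ih (by omega) (by omega)]
      simp

theorem φ_apply_p (h : DualChains A B a b p q φ) (hA : A.IsAlt) (hB : B.IsAlt) {i j : ℕ}
    (hi : i ≤ a) (hj : j < a) : φ i (p j) = 0 := by
  rcases Nat.lt_or_eq_of_le hi with hi | rfl
  · rw [← h.A_p i hi]
    exact (h.chain_p.apply_eq_zero hB hA hi hj).2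
  · obtain ⟨i, rfl⟩ := Nat.exists_eq_add_one_of_ne_zero (Nat.ne_zero_of_lt hj)
    rw [← h.B_p i (by omega)]
    exact (h.chain_p.apply_eq_zero hB hA (by omega) hj).1

theorem apply_q_p (h : DualChains A B a b p q φ) (hA : A.IsAlt) (hB : B.IsAlt) {i j : ℕ}
    (hi : i < a) (hj : j < b) :
    A (q j) (p i) = (-if i = j then 1 else 0) ∧ B (q j) (p i) = -if i + 1 = j then 1 else 0 := by
  rw [← hA.neg_eq, ← hB.neg_eq, h.A_p i hi, h.B_p i hi, h.φ_apply_q hA hB hi.le hj,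
    h.φ_apply_q hA hB hi hj]
  exact ⟨rfl, rfl⟩

/-- The union of the two chains. -/
def family (a b : ℕ) (p q : ℕ → M) : Fin a ⊕ Fin b → M :=
  Sum.elim (fun i => p i) fun j => q j

/-- The functionals dual to the union of the two chains. -/
def dualFamily (A : BilinForm R M) (a b : ℕ) (q : ℕ → M) (φ : ℕ → Dual R M) :
    Fin a ⊕ Fin b → Dual R M :=
  Sum.elim (fun i => -A (q i)) fun j => φ j

theorem dualFamily_apply_family (h : DualChains A B a b p q φ) (hA : A.IsAlt) (hB : B.IsAlt)
    (x y : Fin a ⊕ Fin b) :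
    dualFamily A a b q φ x (family a b p q y) = if x = y then 1 else 0 := by
  obtain ⟨hab, hba⟩ := h.le_and_le_succ
  rcases x with i | i <;> rcases y with j | j <;>
    simp only [dualFamily, family, Sum.elim_inl, Sum.elim_inr, LinearMap.neg_apply]
  · simp [(h.apply_q_p hA hB j.2 (i.2.trans_le hab)).1, Fin.ext_iff, eq_comm]
  · simp [(h.chain_q.apply_eq_zero hA hB (i.2.trans_le hab) j.2).1]
  · simp [h.φ_apply_p hA hB (Nat.le_of_lt_succ (i.2.trans_le hba)) j.2]
  · simp [h.φ_apply_q hA hB (Nat.le_of_lt_succ (i.2.trans_le hba)) j.2, Fin.ext_iff]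

theorem apply_family_eq_zero (h : DualChains A B a b p q φ) {w : M}
    (hw : ∀ x, dualFamily A a b q φ x w = 0) (x : Fin a ⊕ Fin b) :
    A (family a b p q x) w = 0 ∧ B (family a b p q x) w = 0 := by
  have hφ : ∀ i ≤ a, φ i w = 0 := fun i hi => by
    rcases lt_or_ge i b with hib | hib
    · exact hw (Sum.inr ⟨i, hib⟩)
    · rcases h.last with ⟨-, hφa⟩ | ⟨hb, -⟩
      · rw [show i = a by have := h.le_and_le_succ; omega, hφa, LinearMap.zero_apply]
      · omega
  have hAq : ∀ j < b, A (q j) w = 0 := fun j hj => by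
    rcases lt_or_ge j a with hja | hja
    · simpa [dualFamily] using hw (Sum.inl ⟨j, hja⟩)
    · rcases h.last with ⟨hb, -⟩ | ⟨-, hqa⟩
      · omega
      · rw [show j = a by have := h.le_and_le_succ; omega, hqa, LinearMap.zero_apply]
  rcases x with ⟨i, hi⟩ | ⟨j, hj⟩
  · exact ⟨(LinearMap.congr_fun (h.A_p i hi) w).trans (hφ i hi.le),
      (LinearMap.congr_fun (h.B_p i hi) w).trans (hφ (i + 1) hi)⟩
  · refine ⟨hAq j hj, ?_⟩
    rcases j with _ | j
    · exact LinearMap.congr_fun h.B_q_zero w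
    · exact (LinearMap.congr_fun (h.chain_q j hj) w).symm.trans (hAq j (by omega))

theorem apply_family_family (h : DualChains A B a b p q φ) (hA : A.IsAlt) (hB : B.IsAlt)
    (x y : Fin a ⊕ Fin b) :
    A (family a b p q x) (family a b p q y) = skewBlock (bidiagonal a b 1 0) x y ∧
      B (family a b p q x) (family a b p q y) = skewBlock (bidiagonal a b 0 1) x y := by
  have hsuper : ∀ i j : ℕ, (if i = j then (0 : R) else if i + 1 = j then 1 else 0) =
      if i + 1 = j then 1 else 0 := by
    intro i j
    split_ifs <;> first | rfl | omega
  rcases x with i | i <;> rcases y with j | j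
  · exact (h.chain_p.apply_eq_zero hB hA i.2 j.2).symm
  · have hpq := h.apply_q_p hA hB i.2 j.2
    rw [← hA.neg_eq, ← hB.neg_eq]
    simp [family, skewBlock, bidiagonal, hpq, hsuper]
  · simp [family, skewBlock, bidiagonal, h.apply_q_p hA hB j.2 i.2, hsuper]
  · exact h.chain_q.apply_eq_zero hA hB i.2 j.2

theorem splitsOff (h : DualChains A B a b p q φ) (hA : A.IsAlt) (hB : B.IsAlt) :
    SplitsOff A B (skewBlock (bidiagonal a b 1 0)) (skewBlock (bidiagonal a b 0 1)) := by
  convert SplitsOff.of_dual_family (h.dualFamily_apply_family hA hB)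
    fun w hw => h.apply_family_eq_zero hw using 1 <;> ext x y
  · exact (h.apply_family_family hA hB x y).1.symm
  · exact (h.apply_family_family hA hB x y).2.symm

end DualChains

end DualChains

section DualChainStart

open LinearMap (BilinForm)
open Module (Dual)

variable {R M : Type*} [CommRing R] [AddCommGroup M] [Module R M] {A B : BilinForm R M}

/-- The functionals `φ 0` starting a chain `φ 0, …, φ m` with `φ m ∈ T` whose consecutive terms
are `A (p i)` and `B (p i)` for some vectors `p i`. -/
def dualChainStart (A B : BilinForm R M) (T : Submodule R (Dual R M)) :
    ℕ → Submodule R (Dual R M)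
  | 0 => T
  | m + 1 => ((dualChainStart A B T m).comap B).map A

theorem exists_dual_chain_of_mem_dualChainStart {T : Submodule R (Dual R M)} {m : ℕ}
    {φ₀ : Dual R M} (h : φ₀ ∈ dualChainStart A B T m) :
    ∃ (p : ℕ → M) (φ : ℕ → Dual R M), φ 0 = φ₀ ∧
      (∀ i < m, A (p i) = φ i ∧ B (p i) = φ (i + 1)) ∧ φ m ∈ T := by
  induction m generalizing φ₀ with
  | zero => exact ⟨0, fun _ => φ₀, rfl, by simp, h⟩
  | succ m ih =>
    obtain ⟨v, hv, rfl⟩ := h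
    obtain ⟨p, φ, hφ0, hp, hφm⟩ := ih hv
    refine ⟨fun i => Nat.casesOn i v p, fun i => Nat.casesOn i (A v) φ, rfl, ?_, hφm⟩
    rintro (_ | i) hi
    · exact ⟨rfl, hφ0.symm⟩
    · exact hp i (by omega)

end DualChainStart

section Duality

open LinearMap (BilinForm)
open Module (Dual)

variable {K V : Type*} [Field K] [AddCommGroup V] [Module K V] [FiniteDimensional K V]
variable {A B : BilinForm K V}

theorem comap_eq_dualCoannihilator_map (hB : B.IsRefl) (U : Submodule K (Dual K V)) :
    U.comap B = (U.dualCoannihilator.map B).dualCoannihilator := by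
  ext v
  rw [Submodule.mem_comap, ← Subspace.dualCoannihilator_dualAnnihilator_eq (W := U)]
  simp [Submodule.mem_dualAnnihilator, Submodule.mem_dualCoannihilator, hB.eq_iff]

theorem exists_apply_eq_of_mem_dualCoannihilator (hA : A.IsRefl) (hB : B.IsRefl)
    {U : Submodule K (Dual K V)} {x : V} (hx : x ∈ ((U.comap B).map A).dualCoannihilator) :
    ∃ z ∈ U.dualCoannihilator, A x = B z := by
  have hAx : A x ∈ (U.comap B).dualAnnihilator := (Submodule.mem_dualAnnihilator _).2 fun v hv =>
    hA.eq_zero ((Submodule.mem_dualCoannihilator _).1 hx _ (Submodule.mem_map_of_mem hv))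
  rw [comap_eq_dualCoannihilator_map hB, Subspace.dualCoannihilator_dualAnnihilator_eq] at hAx
  obtain ⟨z, hz, hzx⟩ := hAx
  exact ⟨z, hz, hzx.symm⟩

theorem exists_chain_of_mem_dualCoannihilator (hA : A.IsRefl) (hB : B.IsRefl)
    {T : Submodule K (Dual K V)} {m : ℕ} {x : V}
    (hx : x ∈ (dualChainStart A B T m).dualCoannihilator) :
    ∃ z : ℕ → V, z 0 = x ∧ IsPencilChain A B (m + 1) z ∧ z m ∈ T.dualCoannihilator := by
  induction m generalizing x with
  | zero => exact ⟨fun _ => x, rfl, fun i hi => by omega, hx⟩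
  | succ m ih =>
    obtain ⟨y, hy, hxy⟩ := exists_apply_eq_of_mem_dualCoannihilator hA hB hx
    obtain ⟨z, rfl, hz, hzm⟩ := ih hy
    refine ⟨fun i => Nat.casesOn i x z, rfl, ?_, hzm⟩
    rintro (_ | i) hi
    · exact hxy
    · exact hz i (by omega)

theorem exists_mem_apply_eq_one_of_notMem {S : Submodule K (Dual K V)} {Y : Submodule K V}
    {x : V} (hY : S.dualCoannihilator ≤ Y) (hx : x ∉ Y) :
    ∃ φ ∈ S, φ x = 1 ∧ ∀ y ∈ Y, φ y = 0 := by
  obtain ⟨f, hfx, hfY⟩ := Submodule.exists_le_ker_of_notMem hx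
  refine ⟨(f x)⁻¹ • f, S.smul_mem _ ?_, by simp [hfx], fun y hy => ?_⟩
  · rw [← Subspace.dualCoannihilator_dualAnnihilator_eq (W := S), Submodule.mem_dualAnnihilator]
    exact fun y hy => hfY (hY hy)
  · simp [LinearMap.mem_ker.1 (hfY hy)]

theorem exists_dual_functional_or_relation (S : Submodule K (Dual K V)) (q : ℕ → V) (n : ℕ) :
    (∃ φ ∈ S, ∀ j < n + 1, φ (q j) = if j = 0 then 1 else 0) ∨
      ∃ μ : ℕ → K, μ 0 = 1 ∧ ∑ j ∈ Finset.range (n + 1), μ j • q j ∈ S.dualCoannihilator := by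
  set Y := Submodule.span K (Set.range fun j : Fin n => q (j + 1))
  by_cases hq : q 0 ∈ Y ⊔ S.dualCoannihilator
  · obtain ⟨y, hy, s, hs, hys⟩ := Submodule.mem_sup.1 hq
    obtain ⟨c, rfl⟩ := (Submodule.mem_span_range_iff_exists_fun K).1 hy
    refine Or.inr ⟨fun j => Nat.casesOn j 1 fun j => if h : j < n then -c ⟨j, h⟩ else 0, rfl, ?_⟩
    convert hs using 1
    rw [Finset.sum_range_succ', Finset.sum_range]
    simp [← hys]
  · obtain ⟨φ, hφS, hφ0, hφY⟩ := exists_mem_apply_eq_one_of_notMem le_sup_right hq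
    refine Or.inl ⟨φ, hφS, ?_⟩
    rintro (_ | j) hj
    · exact hφ0
    · exact hφY _ (Submodule.mem_sup_left (Submodule.subset_span ⟨⟨j, by omega⟩, rfl⟩))

end Duality

section Chains

open LinearMap (BilinForm)

variable {R M : Type*} [CommRing R] [AddCommGroup M] [Module R M] {A B : BilinForm R M}

theorem IsPencilChain.mono {m n : ℕ} {z : ℕ → M} (hz : IsPencilChain A B n z) (hmn : m ≤ n) :
    IsPencilChain A B m z := fun j hj => hz j (hj.trans_le hmn)

theorem IsPencilChain.exists_append {d m : ℕ} {y z : ℕ → M} (hy : IsPencilChain A B (d + 1) y)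
    (hz : IsPencilChain A B (m + 1) z) (hyz : y d = z 0) :
    ∃ w, IsPencilChain A B (d + m + 1) w ∧ (∀ i ≤ d, w i = y i) ∧ ∀ i, w (d + i) = z i := by
  have hwy : ∀ i ≤ d, (if i < d then y i else z (i - d)) = y i := fun i hi => by
    rcases hi.lt_or_eq with hi | rfl
    · exact if_pos hi
    · simp [hyz]
  have hwz : ∀ i, (if d + i < d then y (d + i) else z (d + i - d)) = z i := fun i => by simp
  refine ⟨fun i => if i < d then y i else z (i - d), fun i hi => ?_, hwy, hwz⟩
  rcases lt_or_ge i d with hid | hdi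
  · simp only [hwy i hid.le, hwy (i + 1) hid]
    exact hy i (by omega)
  · obtain ⟨i, rfl⟩ := Nat.exists_eq_add_of_le hdi
    simp only [hwz i, add_assoc, hwz (i + 1)]
    exact hz i (by omega)

theorem IsPencilChain.exists_extend_zero {d : ℕ} {y : ℕ → M}
    (hy : IsPencilChain A B (d + 1) y) (hyd : y d = 0) :
    ∃ w : ℕ → M, w 0 = y 0 ∧ (∀ j, A (w j) = B (w (j + 1))) ∧ ∀ j, d ≤ j → w j = 0 := by
  refine ⟨fun i => if i < d then y i else 0, ?_, fun j => ?_, fun j hj => if_neg hj.not_gt⟩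
  · rcases d with _ | d
    · exact hyd.symm
    · exact if_pos d.succ_pos
  · rcases lt_trichotomy (j + 1) d with hj | rfl | hj
    · simpa [hj, (lt_add_one j).trans hj] using hy j (by omega)
    · simpa [hyd] using hy j (by omega)
    · simp [hj.not_gt, show ¬j < d by omega]

/-- The vectors `q 0 ≠ 0, …, q (n - 1)` form a Jordan chain of the pencil `B - t A` at `t = 0`. -/
structure IsJordanChain (A B : BilinForm R M) (n : ℕ) (q : ℕ → M) : Prop where
  zero_ne : q 0 ≠ 0
  B_zero : B (q 0) = 0
  chain : IsPencilChain A B n q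

/-- The polynomial `∑ q j t ^ j`, of degree at most `k`, is a null vector of `B - t A`. -/
structure IsNullChain (A B : BilinForm R M) (k : ℕ) (q : ℕ → M) : Prop where
  B_zero : B (q 0) = 0
  A_eq_B_succ : ∀ j, A (q j) = B (q (j + 1))
  eq_zero : ∀ j, k < j → q j = 0

theorem IsJordanChain.append {d m : ℕ} {y z : ℕ → M} (hy : IsJordanChain A B (d + 1) y)
    (hz : IsPencilChain A B (m + 1) z) (hyz : y d = z 0) :
    ∃ w, IsJordanChain A B (d + m + 1) w ∧ ∀ i, w (d + i) = z i := by
  obtain ⟨w, hw, hwy, hwz⟩ := hy.chain.exists_append hz hyz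
  have hw0 : w 0 = y 0 := hwy 0 d.zero_le
  exact ⟨w, ⟨hw0 ▸ hy.zero_ne, hw0 ▸ hy.B_zero, hw⟩, hwz⟩

theorem IsJordanChain.exists_isNullChain {d : ℕ} {y : ℕ → M} (hy : IsJordanChain A B (d + 1) y)
    (hyd : y d = 0) : ∃ q, IsNullChain A B d q ∧ q ≠ 0 := by
  obtain ⟨w, hw0, hw, hwd⟩ := hy.chain.exists_extend_zero hyd
  exact ⟨w, ⟨hw0 ▸ hy.B_zero, hw, fun j hj => hwd j hj.le⟩,
    fun h => hy.zero_ne (hw0 ▸ congr_fun h 0)⟩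

theorem IsNullChain.eq_zero_of_injective {k : ℕ} {q : ℕ → M} (hA : Function.Injective A)
    (hq : IsNullChain A B k q) : q = 0 := by
  have hz : ∀ d j, k < j + d → q j = 0 := by
    intro d
    induction d with
    | zero => exact hq.eq_zero
    | succ d ih =>
      intro j hj
      exact hA (by rw [hq.A_eq_B_succ, ih _ (by omega), map_zero, map_zero])
  exact funext fun j => hz (k + 1) j (by omega)

theorem IsNullChain.last_ne_zero {k : ℕ} {q : ℕ → M} (hq : IsNullChain A B k q) (hne : q ≠ 0)
    (hmin : ∀ k' < k, ∀ q', IsNullChain A B k' q' → q' = 0) : q k ≠ 0 := by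
  intro hqk
  rcases k with _ | k
  · refine hne (funext ?_)
    rintro (_ | j)
    · exact hqk
    · exact hq.eq_zero _ j.succ_pos
  · refine hne (hmin k k.lt_succ_self q ⟨hq.B_zero, hq.A_eq_B_succ, fun j hj => ?_⟩)
    rcases (Nat.succ_le_of_lt hj).lt_or_eq with hj | rfl
    · exact hq.eq_zero j hj
    · exact hqk

/-- `z i - ∑ μ j q (j + i)` is a null chain starting with `0`, and dropping that term lowers its
degree. -/
theorem IsNullChain.sub_shift {k : ℕ} {q z : ℕ → M} (hq : IsNullChain A B (k + 1) q) {μ : ℕ → R}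
    (hz0 : z 0 = ∑ j ∈ Finset.range (k + 2), μ j • q j)
    (hz : ∀ i, A (z i) = B (z (i + 1))) (hzk : ∀ i, k < i → z i = 0) :
    IsNullChain A B k fun i => z (i + 1) - ∑ j ∈ Finset.range (k + 2), μ j • q (j + i + 1) := by
  refine ⟨?_, fun i => ?_, fun i hi => ?_⟩
  · simp only [map_sub, map_sum, map_smul, ← hz, ← hq.A_eq_B_succ, hz0]
    simp
  · simp only [map_sub, map_sum, map_smul, hz, hq.A_eq_B_succ, add_assoc]
  · rw [hzk _ (by omega), Finset.sum_eq_zero fun j _ => by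
      rw [hq.eq_zero _ (by omega), smul_zero], sub_zero]

end Chains

section Summands

open LinearMap (BilinForm)
open JKBlock (bidiagonal)

variable {K V : Type*} [Field K] [AddCommGroup V] [Module K V] {A B : BilinForm K V}

theorem IsJordanChain.exists_last_eq_sum {n : ℕ} {q : ℕ → V} (hq : IsJordanChain A B n q) {N : ℕ}
    (hN : N ≤ n) {c : ℕ → K} (hc : ∃ j < N, c j ≠ 0) :
    ∃ d y, IsJordanChain A B (d + 1) y ∧ y d = ∑ j ∈ Finset.range N, c j • q j := by
  induction N generalizing c with
  | zero => simp at hc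
  | succ N ih =>
    by_cases hc' : ∃ j < N, c (j + 1) ≠ 0
    · obtain ⟨d, y, hy, hyd⟩ := ih (by omega) hc'
      set x := ∑ j ∈ Finset.range (N + 1), c j • q j with hx
      have hA : A (y d) = B x := by
        rw [hyd, hx, Finset.sum_range_succ', map_add, map_smul, hq.B_zero, smul_zero, add_zero,
          map_sum, map_sum]
        refine Finset.sum_congr rfl fun j hj => ?_
        rw [map_smul, map_smul, hq.chain j (by have := Finset.mem_range.1 hj; omega)]
      have hz : IsPencilChain A B 2 fun i => Nat.casesOn i (y d) fun _ => x := fun i hi => by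
        obtain rfl : i = 0 := by omega
        exact hA
      obtain ⟨w, hw, hwz⟩ := hy.append (m := 1) hz rfl
      exact ⟨d + 1, w, hw, hwz 1⟩
    · push Not at hc'
      have hsum : ∑ j ∈ Finset.range (N + 1), c j • q j = c 0 • q 0 := by
        rw [Finset.sum_range_succ', Finset.sum_eq_zero fun j hj => by
          rw [hc' j (Finset.mem_range.1 hj), zero_smul], zero_add]
      have hc0 : c 0 ≠ 0 := by
        obtain ⟨_ | j, hj, hcj⟩ := hc
        · exact hcj
        · exact absurd (hc' j (by omega)) hcj
      exact ⟨0, fun _ => c 0 • q 0, ⟨smul_ne_zero hc0 hq.zero_ne, by simp [hq.B_zero],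
        fun i hi => by omega⟩, hsum.symm⟩

theorem IsJordanChain.length_le_finrank [FiniteDimensional K V]
    (hnull : ∀ k q, IsNullChain A B k q → q = 0) {n : ℕ} {q : ℕ → V}
    (hq : IsJordanChain A B n q) : n ≤ Module.finrank K V := by
  have hli : LinearIndependent K fun j : Fin n => q j := by
    rw [Fintype.linearIndependent_iff]
    by_contra! ⟨c, hsum, j, hj⟩
    obtain ⟨d, y, hy, hyd⟩ := hq.exists_last_eq_sum le_rfl
      (c := fun j => if h : j < n then c ⟨j, h⟩ else 0) ⟨j, j.2, by simpa using hj⟩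
    obtain ⟨q', hq', hne⟩ := hy.exists_isNullChain (by rw [hyd, Finset.sum_range]; simpa using hsum)
    exact hne (hnull d q' hq')
  simpa using hli.fintype_card_le_finrank

theorem IsJordanChain.splitsOff_of_maximal [FiniteDimensional K V] (hA : A.IsAlt) (hB : B.IsAlt)
    {n : ℕ} {q : ℕ → V} (hq : IsJordanChain A B (n + 1) q)
    (hmax : ∀ q', ¬IsJordanChain A B (n + 2) q') :
    SplitsOff A B (skewBlock (bidiagonal (n + 1) (n + 1) 1 0))
      (skewBlock (bidiagonal (n + 1) (n + 1) 0 1)) := by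
  obtain ⟨φ₀, hφ₀, hφq⟩ | ⟨μ, hμ, hμq⟩ :=
    exists_dual_functional_or_relation (dualChainStart A B ⊥ (n + 1)) q n
  · obtain ⟨p, φ, rfl, hp, hφ⟩ := exists_dual_chain_of_mem_dualChainStart hφ₀
    exact DualChains.splitsOff ⟨fun i hi => (hp i hi).1, fun i hi => (hp i hi).2, hq.chain,
      hq.B_zero, Or.inl ⟨rfl, hφ⟩, hφq⟩ hA hB
  · obtain ⟨z, hz0, hz, -⟩ := exists_chain_of_mem_dualCoannihilator hA.isRefl hB.isRefl hμq
    obtain ⟨d, y, hy, hyd⟩ := hq.exists_last_eq_sum le_rfl ⟨0, n.succ_pos, hμ ▸ one_ne_zero⟩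
    obtain ⟨w, hw, -⟩ := hy.append hz (hyd.trans hz0.symm)
    exact absurd ⟨hw.zero_ne, hw.B_zero, hw.chain.mono (by omega)⟩ (hmax w)

theorem IsNullChain.sum_notMem_dualCoannihilator [FiniteDimensional K V] (hA : A.IsRefl)
    (hB : B.IsRefl) {k : ℕ} {q : ℕ → V} (hq : IsNullChain A B k q) (hne : q ≠ 0)
    (hmin : ∀ k' < k, ∀ q', IsNullChain A B k' q' → q' = 0) {μ : ℕ → K} (hμ : μ 0 = 1) :
    ∑ j ∈ Finset.range (k + 1), μ j • q j ∉ (dualChainStart A B ⊤ k).dualCoannihilator := by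
  intro hμq
  obtain ⟨y, hy0, hy, hyk⟩ := exists_chain_of_mem_dualCoannihilator hA hB hμq
  rw [Submodule.dualCoannihilator_top, Submodule.mem_bot] at hyk
  refine hq.last_ne_zero hne hmin ?_
  rcases k with _ | k
  · simpa [hyk, hμ] using hy0.symm
  · obtain ⟨z, hz0, hz, hzk⟩ := hy.exists_extend_zero hyk
    have hshift := congr_fun (hmin k k.lt_succ_self _ (hq.sub_shift (hz0.trans hy0) hz hzk)) k
    simpa [hzk, hμ, Finset.sum_range_succ', hq.eq_zero] using hshift

theorem IsNullChain.splitsOff_of_minimal [FiniteDimensional K V] (hA : A.IsAlt) (hB : B.IsAlt)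
    {k : ℕ} {q : ℕ → V} (hq : IsNullChain A B k q) (hne : q ≠ 0)
    (hmin : ∀ k' < k, ∀ q', IsNullChain A B k' q' → q' = 0) :
    SplitsOff A B (skewBlock (bidiagonal k (k + 1) 1 0))
      (skewBlock (bidiagonal k (k + 1) 0 1)) := by
  obtain ⟨φ₀, hφ₀, hφq⟩ | ⟨μ, hμ, hμq⟩ :=
    exists_dual_functional_or_relation (dualChainStart A B ⊤ k) q k
  · obtain ⟨p, φ, rfl, hp, -⟩ := exists_dual_chain_of_mem_dualChainStart hφ₀
    have hAqk : A (q k) = 0 := by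
      rw [hq.A_eq_B_succ, hq.eq_zero (k + 1) k.lt_succ_self, map_zero]
    exact DualChains.splitsOff ⟨fun i hi => (hp i hi).1, fun i hi => (hp i hi).2,
      fun j _ => hq.A_eq_B_succ j, hq.B_zero, Or.inr ⟨rfl, hAqk⟩, hφq⟩ hA hB
  · exact absurd hμq (hq.sum_notMem_dualCoannihilator hA.isRefl hB.isRefl hne hmin hμ)

end Summands

section Decomposition

open LinearMap (BilinForm)
open JKBlock (bidiagonal)

theorem isAlt_of_ringChar_ne_two {R M : Type*} [CommRing R] [NoZeroDivisors R] [Nontrivial R]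
    [AddCommGroup M] [Module R M] (hR : ringChar R ≠ 2) {A : BilinForm R M}
    (hA : ∀ u v, A u v = -A v u) : A.IsAlt := fun v =>
  (Ring.eq_self_iff_eq_zero_of_char_ne_two hR).1 (hA v v).symm

variable {K V : Type*} [Field K] [AddCommGroup V] [Module K V] [FiniteDimensional K V]
variable {A B : BilinForm K V}

theorem exists_splitsOff_jordan (hA : A.IsAlt) (hB : B.IsAlt)
    (hnull : ∀ k q, IsNullChain A B k q → q = 0) {v : V} (hv : v ≠ 0) (hBv : B v = 0) :
    ∃ n, SplitsOff A B (skewBlock (bidiagonal (n + 1) (n + 1) 1 0))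
      (skewBlock (bidiagonal (n + 1) (n + 1) 0 1)) := by
  by_contra! hcon
  have hchain : ∀ n, ∃ q, IsJordanChain A B (n + 1) q := by
    intro n
    induction n with
    | zero => exact ⟨fun _ => v, hv, hBv, fun j hj => by omega⟩
    | succ n ih =>
      obtain ⟨q, hq⟩ := ih
      by_contra! hmax
      exact hcon n (hq.splitsOff_of_maximal hA hB hmax)
  obtain ⟨q, hq⟩ := hchain (Module.finrank K V)
  exact (hq.length_le_finrank hnull).not_gt (Nat.lt_succ_self _)

theorem exists_sub_smul_apply_eq_zero [IsAlgClosed K] [Nontrivial V] (A : BilinForm K V)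
    (hB : Function.Injective B) : ∃ c : K, ∃ v ≠ 0, (A - c • B) v = 0 := by
  let E : V ≃ₗ[K] Module.Dual K V :=
    LinearEquiv.ofInjectiveOfFinrankEq B hB Subspace.dual_finrank_eq.symm
  obtain ⟨c, hc⟩ := Module.End.exists_eigenvalue (E.symm.toLinearMap ∘ₗ A)
  obtain ⟨v, hv⟩ := hc.exists_hasEigenvector
  have hAv : A v = E (c • v) := by
    rw [← hv.apply_eq_smul, LinearMap.comp_apply, LinearEquiv.coe_coe, E.apply_symm_apply]
  exact ⟨c, v, hv.2, sub_eq_zero.2 (hAv.trans (map_smul E c v))⟩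

theorem exists_splitsOff_jkBlock [IsAlgClosed K] [Nontrivial V] (hA : A.IsAlt) (hB : B.IsAlt) :
    ∃ b : JKBlock K, SplitsOff A B b.matA b.matB := by
  classical
  by_cases hnull : ∃ k q, IsNullChain A B k q ∧ q ≠ 0
  · obtain ⟨q, hq, hne⟩ := Nat.find_spec hnull
    refine ⟨.kronecker _, hq.splitsOff_of_minimal hA hB hne fun k hk q' hq' => ?_⟩
    by_contra hne'
    exact Nat.find_min hnull hk ⟨q', hq', hne'⟩
  push Not at hnull
  by_cases hker : Function.Injective B
  · obtain ⟨c, v, hv, hv0⟩ := exists_sub_smul_apply_eq_zero A hker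
    obtain ⟨n, h⟩ := exists_splitsOff_jordan hB (hA.sub (hB.smul c))
      (fun _ _ hq => hq.eq_zero_of_injective hker) hv hv0
    have hAB := h.of_sub_smul
    rw [skewBlock_add_smul, bidiagonal_add_smul] at hAB
    exact ⟨.jordan (n + 1) n.succ_pos c, hAB⟩
  · rw [← LinearMap.ker_eq_bot] at hker
    obtain ⟨v, hBv, hv⟩ := Submodule.exists_mem_ne_zero_of_ne_bot hker
    obtain ⟨n, h⟩ := exists_splitsOff_jordan hA hB hnull hv hBv
    exact ⟨.jordanInfty (n + 1) n.succ_pos, h⟩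

theorem JKBlock.index_nonempty {K : Type*} (b : JKBlock K) : Nonempty b.Index := by
  cases b with
  | jordan n hn _ => exact ⟨Sum.inl ⟨0, hn⟩⟩
  | jordanInfty n hn => exact ⟨Sum.inl ⟨0, hn⟩⟩
  | kronecker k => exact ⟨Sum.inr ⟨0, k.succ_pos⟩⟩

end Decomposition

theorem theorem1_general {K : Type*} [Field K] [IsAlgClosed K]
    {V : Type*} [AddCommGroup V] [Module K V] [FiniteDimensional K V]
    (A B : LinearMap.BilinForm K V) (hA : A.IsAlt) (hB : B.IsAlt) :
    ∃ (m : ℕ) (blk : Fin m → JKBlock K)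
      (e : Module.Basis (Σ i : Fin m, (blk i).Index) K V),
      LinearMap.BilinForm.toMatrix e A = Matrix.blockDiagonal' (fun i => (blk i).matA) ∧
      LinearMap.BilinForm.toMatrix e B = Matrix.blockDiagonal' (fun i => (blk i).matB) := by
  induction hd : Module.finrank K V using Nat.strong_induction_on generalizing V with
  | _ d ih =>
    rcases subsingleton_or_nontrivial V with _ | _
    · exact ⟨0, Fin.elim0, .empty V, Subsingleton.elim _ _, Subsingleton.elim _ _⟩
    · obtain ⟨b, U, W, hUW, horth, hU⟩ := exists_splitsOff_jkBlock hA hB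
      have hUpos : 0 < Module.finrank K U := by
        obtain ⟨e, -⟩ := hU
        rw [Module.finrank_eq_card_basis e]
        exact Fintype.card_pos_iff.2 b.index_nonempty
      have hWd : Module.finrank K W < d := by
        have := Submodule.finrank_add_eq_of_isCompl hUW
        omega
      obtain ⟨m, blk, hW⟩ := ih _ hWd (A.restrict W) (B.restrict W) (fun w => hA w)
        (fun w => hB w) rfl
      exact ⟨m + 1, Fin.cons b blk,
        HasMatrices.blockDiagonal' hA.isRefl hB.isRefl hUW horth hU hW⟩

theorem theorem1 {K : Type*} [Field K] [IsAlgClosed K] (hK : ringChar K ≠ 2)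
    {V : Type*} [AddCommGroup V] [Module K V] [FiniteDimensional K V]
    (A B : LinearMap.BilinForm K V)
    (hA : ∀ u v : V, A u v = -A v u) (hB : ∀ u v : V, B u v = -B v u) :
    ∃ (m : ℕ) (blk : Fin m → JKBlock K)
      (e : Module.Basis (Σ i : Fin m, (blk i).Index) K V),
      LinearMap.BilinForm.toMatrix e A = Matrix.blockDiagonal' (fun i => (blk i).matA) ∧
      LinearMap.BilinForm.toMatrix e B = Matrix.blockDiagonal' (fun i => (blk i).matB) :=
  theorem1_general A B (isAlt_of_ringChar_ne_two hK hA) (isAlt_of_ringChar_ne_two hK hB)
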